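/- Let $(\Sigma,h)$ be a smooth ($C^\infty$) Riemannian manifold without boundary, of dimension $n$, with Levi-Civita connection $D$. Let $f:\Sigma\to\mathbb R$ be a $C^\infty$ function which is strictly convex (its Hessian is positive definite: $V^iV^jD_iD_jf>0$ for every non-zero tangent vector $V$ at every point) or uniformly convex (there is a constant $c>0$ such that $V^iV^jD_iD_jf\ge c\,h_{ij}V^iV^j$ for every tangent vector $V$ at every point). Then: (1) $(\Sigma,h)$ admits no closed geodesic, that is, there is no non-constant smooth periodic curve $\gamma:\mathbb R\to\Sigma$ with $D_{\dot\gamma}\dot\gamma=0$. (2) For every open interval $J\subseteq\mathbb R$ and every affinely parametrized geodesic $\gamma:J\to\Sigma$ (a smooth curve with $D_{\dot\gamma}\dot\gamma=0$), one has $\dfrac{d^2 f(\gamma(s))}{ds^2}>0$ at every $s\in J$ with $\dot\gamma(s)\neq 0$. -/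

import Mathlib

open scoped Manifold ContDiff

noncomputable section

namespace RiemConvex

variable {n : ℕ} {M : Type*} [TopologicalSpace M] [ChartedSpace (EuclideanSpace ℝ (Fin n)) M]

/-- The `i`-th standard basis vector of `ℝⁿ`. -/
def stdVec (i : Fin n) : EuclideanSpace ℝ (Fin n) := EuclideanSpace.single i 1

/-- The partial derivative `∂F/∂xⁱ` at `y` of a function on (an open subset of) `ℝⁿ`. -/
def partialDeriv (i : Fin n) (F : EuclideanSpace ℝ (Fin n) → ℝ)
    (y : EuclideanSpace ℝ (Fin n)) : ℝ :=
  fderiv ℝ F y (stdVec i)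

/-- The coordinate vector `∂/∂xⁱ` of the chart at `x₀`, at the point with coordinates `y`. -/
def coordVec (x₀ : M) (i : Fin n) (y : EuclideanSpace ℝ (Fin n)) :
    TangentSpace (𝓡 n) ((extChartAt (𝓡 n) x₀).symm y) :=
  mfderiv (𝓡 n) (𝓡 n) (extChartAt (𝓡 n) x₀).symm y (stdVec i)

section Metric

variable [IsManifold (𝓡 n) ∞ M]
  (h : Bundle.ContMDiffRiemannianMetric (𝓡 n) ∞ (EuclideanSpace ℝ (Fin n))
    (TangentSpace (𝓡 n) : M → Type _))

/-- The components `h_ij` of the metric in the chart at `x₀`, as functions of the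
coordinates `y`. -/
def metricCoord (x₀ : M) (i j : Fin n) (y : EuclideanSpace ℝ (Fin n)) : ℝ :=
  h.inner ((extChartAt (𝓡 n) x₀).symm y) (coordVec x₀ i y) (coordVec x₀ j y)

/-- The components `h^ij` of the inverse metric in the chart at `x₀`. -/
def invMetricCoord (x₀ : M) (i j : Fin n) (y : EuclideanSpace ℝ (Fin n)) : ℝ :=
  (Matrix.of fun a b : Fin n => metricCoord h x₀ a b y)⁻¹ i j

/-- The Christoffel symbols of the Levi-Civita connection in the chart at `x₀`:
`Γ^k_ij = ½ h^kl (∂_i h_jl + ∂_j h_il - ∂_l h_ij)`. -/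
def christoffel (x₀ : M) (k i j : Fin n) (y : EuclideanSpace ℝ (Fin n)) : ℝ :=
  (1 / 2 : ℝ) * ∑ l : Fin n, invMetricCoord h x₀ k l y *
    (partialDeriv i (metricCoord h x₀ j l) y + partialDeriv j (metricCoord h x₀ i l) y
      - partialDeriv l (metricCoord h x₀ i j) y)

/-- The components `D_i D_j f = ∂_i ∂_j f - Γ^k_ij ∂_k f` of the Hessian of `f` in the chart
at `x₀`, at the point with coordinates `y`. -/
def hessianCoord (f : M → ℝ) (x₀ : M) (i j : Fin n) (y : EuclideanSpace ℝ (Fin n)) : ℝ :=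
  partialDeriv i (partialDeriv j (f ∘ (extChartAt (𝓡 n) x₀).symm)) y
    - ∑ k : Fin n, christoffel h x₀ k i j y
        * partialDeriv k (f ∘ (extChartAt (𝓡 n) x₀).symm) y

/-- The `i`-th component, in the chart at `p`, of a tangent vector `v` at `p`. -/
def vecCoord {p : M} (v : TangentSpace (𝓡 n) p) (i : Fin n) : ℝ :=
  (show EuclideanSpace ℝ (Fin n) from mfderiv (𝓡 n) (𝓡 n) (extChartAt (𝓡 n) p) p v) i

/-- The Hessian `V^i W^j D_i D_j f` of `f` at `p`, with `D` the Levi-Civita connection. It is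
computed in the preferred chart at `p`; the value does not depend on the chart. -/
def hessian (f : M → ℝ) (p : M) (v w : TangentSpace (𝓡 n) p) : ℝ :=
  ∑ i : Fin n, ∑ j : Fin n, vecCoord v i * vecCoord w j
    * hessianCoord h f p i j (extChartAt (𝓡 n) p p)

/-- A smooth function whose Hessian is positive definite at every point. -/
def IsStrictlyConvex (f : M → ℝ) : Prop :=
  ContMDiff (𝓡 n) 𝓘(ℝ, ℝ) ∞ f ∧
    ∀ (p : M) (v : TangentSpace (𝓡 n) p), v ≠ 0 → 0 < hessian h f p v v

/-- A smooth function such that `D_i D_j f ≥ c h_ij` for some constant `c > 0`. -/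
def IsUniformlyConvex (f : M → ℝ) : Prop :=
  ContMDiff (𝓡 n) 𝓘(ℝ, ℝ) ∞ f ∧
    ∃ c : ℝ, 0 < c ∧ ∀ (p : M) (v : TangentSpace (𝓡 n) p),
      c * h.inner p v v ≤ hessian h f p v v

/-- The velocity `γ'(t)` of a curve. -/
def velocity (γ : ℝ → M) (t : ℝ) : TangentSpace (𝓡 n) (γ t) :=
  mfderiv 𝓘(ℝ, ℝ) (𝓡 n) γ t (1 : ℝ)

/-- The `i`-th coordinate of the curve `γ` in the chart at `x₀`. -/
def curveCoord (x₀ : M) (γ : ℝ → M) (i : Fin n) (s : ℝ) : ℝ :=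
  extChartAt (𝓡 n) x₀ (γ s) i

/-- The `k`-th component of the covariant acceleration `D_{γ'} γ'` at time `t`, in the chart at
`γ t`: `(x^k)'' + Γ^k_ij (x^i)' (x^j)'`. -/
def covAccel (γ : ℝ → M) (t : ℝ) (k : Fin n) : ℝ :=
  deriv (deriv (curveCoord (γ t) γ k)) t
    + ∑ i : Fin n, ∑ j : Fin n, christoffel h (γ t) k i j (extChartAt (𝓡 n) (γ t) (γ t))
        * deriv (curveCoord (γ t) γ i) t * deriv (curveCoord (γ t) γ j) t

/-- `γ` is an (affinely parametrized) geodesic on the set of parameters `J`, which is meant to be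
open: it is smooth and satisfies the geodesic equation `D_{γ'} γ' = 0`. -/
def IsGeodesicOn (γ : ℝ → M) (J : Set ℝ) : Prop :=
  ContMDiffOn 𝓘(ℝ, ℝ) (𝓡 n) ∞ γ J ∧ ∀ t ∈ J, ∀ k : Fin n, covAccel h γ t k = 0

/-- `γ` is a closed geodesic: a non-constant periodic geodesic defined on `ℝ`. -/
def IsClosedGeodesic (γ : ℝ → M) : Prop :=
  IsGeodesicOn h γ Set.univ ∧ (∃ T : ℝ, 0 < T ∧ Function.Periodic γ T) ∧ ∃ s t : ℝ, γ s ≠ γ t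

end Metric

end RiemConvex

end

/-! In the chart at `γ s` the chain rule gives `(f ∘ γ)'' = ∂_i∂_j f ẋ^i ẋ^j + ∂_k f ẍ^k`. The
geodesic equation turns `ẍ^k` into `-Γ^k_ij ẋ^i ẋ^j`, so the sum is the Hessian of `f` on the
velocity (`deriv_deriv_comp_eq_hessian`), which is positive when the velocity is non-zero. On a
closed geodesic `f ∘ γ` is periodic and convex, hence its second derivative vanishes
(`deriv_deriv_eq_zero_of_periodic`); so the velocity vanishes everywhere and `γ` is constant
(`eq_of_velocity_eq_zero`). -/

namespace RiemConvex

open Filter Topology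

section Euclidean

variable {n : ℕ}

/-- The chain rule in coordinates for a function along a curve in `ℝⁿ`. -/
theorem deriv_comp_eq_sum_partialDeriv {G : EuclideanSpace ℝ (Fin n) → ℝ}
    {x : ℝ → EuclideanSpace ℝ (Fin n)} {s : ℝ} (hG : DifferentiableAt ℝ G (x s))
    (hx : DifferentiableAt ℝ x s) :
    deriv (G ∘ x) s = ∑ i, partialDeriv i G (x s) * deriv (fun t => x t i) s := by
  have hi : ∀ i, deriv (fun t => x t i) s = (deriv x s) i := fun i =>
    ((EuclideanSpace.proj (𝕜 := ℝ) i).hasFDerivAt.comp_hasDerivAt s hx.hasDerivAt).deriv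
  have hsum : deriv x s = ∑ i, (deriv x s) i • stdVec i := by
    simpa [stdVec] using ((EuclideanSpace.basisFun (Fin n) ℝ).sum_repr (deriv x s)).symm
  rw [(hG.hasFDerivAt.comp_hasDerivAt s hx.hasDerivAt).deriv, hsum, map_sum]
  refine Finset.sum_congr rfl fun i _ => ?_
  rw [map_smul, smul_eq_mul, hi, partialDeriv, mul_comm]

theorem contDiffAt_partialDeriv {G : EuclideanSpace ℝ (Fin n) → ℝ}
    {y : EuclideanSpace ℝ (Fin n)} (hG : ContDiffAt ℝ ∞ G y) (i : Fin n) :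
    ContDiffAt ℝ ∞ (partialDeriv i G) y :=
  (hG.fderiv_right (m := ∞) le_rfl).clm_apply contDiffAt_const

/-- The second derivative of a function along a curve in `ℝⁿ`. -/
theorem deriv_deriv_comp_eq_sum {F : EuclideanSpace ℝ (Fin n) → ℝ}
    {x : ℝ → EuclideanSpace ℝ (Fin n)} {s : ℝ} (hF : ContDiffAt ℝ ∞ F (x s))
    (hx : ContDiffAt ℝ ∞ x s) :
    deriv (deriv (F ∘ x)) s = ∑ j,
      ((∑ i, partialDeriv i (partialDeriv j F) (x s) * deriv (fun t => x t i) s)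
          * deriv (fun t => x t j) s
        + partialDeriv j F (x s) * deriv (deriv fun t => x t j) s) := by
  have hxi : ∀ i, ContDiffAt ℝ ∞ (fun t => x t i) s := fun i =>
    (EuclideanSpace.proj (𝕜 := ℝ) i).contDiff.contDiffAt.comp s hx
  have hdx : ∀ i, DifferentiableAt ℝ (deriv fun t => x t i) s := fun i =>
    (((hxi i).fderiv_right (m := ∞) le_rfl).clm_apply
      (contDiffAt_const (c := (1 : ℝ)))).differentiableAt (by simp)
  have hxd : DifferentiableAt ℝ x s := hx.differentiableAt (by simp)
  have hFe : ∀ᶠ y in 𝓝 (x s), DifferentiableAt ℝ F y :=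
    ((hF.of_le (m := 1) (by simp)).eventually (by simp)).mono
      fun y hy => hy.differentiableAt (by simp)
  have hxe : ∀ᶠ t in 𝓝 s, DifferentiableAt ℝ x t :=
    ((hx.of_le (m := 1) (by simp)).eventually (by simp)).mono
      fun y hy => hy.differentiableAt (by simp)
  have hev : deriv (F ∘ x) =ᶠ[𝓝 s]
      fun t => ∑ j, (partialDeriv j F ∘ x) t * deriv (fun t => x t j) t := by
    filter_upwards [hxd.continuousAt.eventually hFe, hxe] with t h₁ h₂
    exact deriv_comp_eq_sum_partialDeriv h₁ h₂
  have hP : ∀ j, DifferentiableAt ℝ (partialDeriv j F) (x s) := fun j =>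
    (contDiffAt_partialDeriv hF j).differentiableAt (by simp)
  have hPx : ∀ j, DifferentiableAt ℝ (partialDeriv j F ∘ x) s := fun j => (hP j).comp s hxd
  rw [hev.deriv_eq, deriv_fun_sum fun j _ => (hPx j).fun_mul (hdx j)]
  refine Finset.sum_congr rfl fun j _ => ?_
  rw [deriv_fun_mul (hPx j) (hdx j), deriv_comp_eq_sum_partialDeriv (hP j) hxd]
  rfl

end Euclidean

variable {n : ℕ} {M : Type*} [TopologicalSpace M] [ChartedSpace (EuclideanSpace ℝ (Fin n)) M]

theorem contDiffAt_extChartAt_comp {γ : ℝ → M} {s : ℝ}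
    (hγ : ContMDiffAt 𝓘(ℝ, ℝ) (𝓡 n) ∞ γ s) :
    ContDiffAt ℝ ∞ (extChartAt (𝓡 n) (γ s) ∘ γ) s :=
  ((contMDiffAt_extChartAt (I := 𝓡 n)).comp s hγ).contDiffAt

/-- Links the manifold derivative fed to `hessian` with the coordinate derivatives used in
`covAccel`. -/
theorem vecCoord_velocity {γ : ℝ → M} {s : ℝ} (hγ : ContMDiffAt 𝓘(ℝ, ℝ) (𝓡 n) ∞ γ s)
    (i : Fin n) : vecCoord (velocity (n := n) γ s) i = deriv (curveCoord (γ s) γ i) s := by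
  have hx := (contDiffAt_extChartAt_comp hγ).differentiableAt (by simp)
  have h₁ : deriv (curveCoord (γ s) γ i) s = (deriv (extChartAt (𝓡 n) (γ s) ∘ γ) s) i :=
    ((EuclideanSpace.proj (𝕜 := ℝ) i).hasFDerivAt.comp_hasDerivAt s hx.hasDerivAt).deriv
  have h₂ := mfderiv_comp (I := 𝓘(ℝ, ℝ)) (I' := 𝓡 n) (I'' := 𝓡 n) s
    ((contMDiffAt_extChartAt (I := 𝓡 n) (n := ∞) (x := γ s)).mdifferentiableAt (by simp))
    (hγ.mdifferentiableAt (by simp))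
  rw [mfderiv_eq_fderiv] at h₂
  rw [h₁, ← fderiv_apply_one_eq_deriv, h₂]
  rfl

variable [IsManifold (𝓡 n) ∞ M]

theorem contDiffAt_comp_extChartAt_symm {f : M → ℝ} (hf : ContMDiff (𝓡 n) 𝓘(ℝ, ℝ) ∞ f) (p : M) :
    ContDiffAt ℝ ∞ (f ∘ (extChartAt (𝓡 n) p).symm) (extChartAt (𝓡 n) p p) := by
  have h₁ : ContMDiffAt 𝓘(ℝ, EuclideanSpace ℝ (Fin n)) (𝓡 n) ∞ (extChartAt (𝓡 n) p).symm
      (extChartAt (𝓡 n) p p) :=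
    (contMDiffOn_extChartAt_symm p).contMDiffAt (extChartAt_target_mem_nhds p)
  exact (hf.contMDiffAt.comp _ h₁).contDiffAt

variable (h : Bundle.ContMDiffRiemannianMetric (𝓡 n) ∞ (EuclideanSpace ℝ (Fin n))
  (TangentSpace (𝓡 n) : M → Type _))

/-- Along a curve with vanishing covariant acceleration, the second derivative of a function is
its Hessian evaluated on the velocity. -/
theorem deriv_deriv_comp_eq_hessian {f : M → ℝ} (hf : ContMDiff (𝓡 n) 𝓘(ℝ, ℝ) ∞ f)
    {γ : ℝ → M} {s : ℝ} (hγ : ContMDiffAt 𝓘(ℝ, ℝ) (𝓡 n) ∞ γ s)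
    (hacc : ∀ k, covAccel h γ s k = 0) :
    deriv (deriv (f ∘ γ)) s = hessian h f (γ s) (velocity γ s) (velocity γ s) := by
  set F := f ∘ (extChartAt (𝓡 n) (γ s)).symm with hFdef
  set x := extChartAt (𝓡 n) (γ s) ∘ γ with hxdef
  -- The curve stays in the chart only near `s`; equality of germs is enough for second derivatives.
  have hev : f ∘ γ =ᶠ[𝓝 s] F ∘ x := by
    filter_upwards [hγ.continuousAt.eventually (extChartAt_source_mem_nhds (I := 𝓡 n) (γ s))]
      with t ht
    simp only [hFdef, hxdef, Function.comp_apply]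
    rw [(extChartAt (𝓡 n) (γ s)).left_inv ht]
  -- `covAccel` at `s` uses the same chart at `γ s` that defines `x`, so no change of chart is
  -- needed.
  have hacc' : ∀ k, deriv (deriv fun t => x t k) s =
      -∑ i, ∑ j, christoffel h (γ s) k i j (x s)
        * deriv (fun t => x t i) s * deriv (fun t => x t j) s :=
    fun k => eq_neg_of_add_eq_zero_left (hacc k)
  have hsum : ∑ k, partialDeriv k F (x s) * deriv (deriv fun t => x t k) s =
      -∑ i, ∑ j, deriv (fun t => x t i) s * deriv (fun t => x t j) s
        * ∑ k, christoffel h (γ s) k i j (x s) * partialDeriv k F (x s) := by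
    simp only [hacc', mul_neg, Finset.sum_neg_distrib, Finset.mul_sum]
    rw [Finset.sum_comm]
    congr 1
    refine Finset.sum_congr rfl fun i _ => ?_
    rw [Finset.sum_comm]
    exact Finset.sum_congr rfl fun j _ => Finset.sum_congr rfl fun k _ => by ring
  have hsum' : ∑ j, (∑ i, partialDeriv i (partialDeriv j F) (x s) * deriv (fun t => x t i) s)
        * deriv (fun t => x t j) s =
      ∑ i, ∑ j, deriv (fun t => x t i) s * deriv (fun t => x t j) s
        * partialDeriv i (partialDeriv j F) (x s) := by
    simp only [Finset.sum_mul]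
    rw [Finset.sum_comm]
    exact Finset.sum_congr rfl fun i _ => Finset.sum_congr rfl fun j _ => by ring
  rw [hev.deriv.deriv_eq, deriv_deriv_comp_eq_sum (contDiffAt_comp_extChartAt_symm hf (γ s))
    (contDiffAt_extChartAt_comp hγ), Finset.sum_add_distrib, hsum, hsum', ← sub_eq_add_neg]
  simp only [hessian, vecCoord_velocity hγ, hessianCoord, mul_sub, Finset.sum_sub_distrib]
  rfl

theorem hessian_pos {f : M → ℝ} (hf : IsStrictlyConvex h f ∨ IsUniformlyConvex h f) {p : M}
    {v : TangentSpace (𝓡 n) p} (hv : v ≠ 0) : 0 < hessian h f p v v := by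
  rcases hf with hf | ⟨-, c, hc, hf⟩
  · exact hf.2 p v hv
  · exact (mul_pos hc (h.pos p v hv)).trans_le (hf p v)

@[simp]
theorem hessian_zero (f : M → ℝ) (p : M) : hessian h f p 0 0 = 0 := by
  have hv : ∀ i, vecCoord (0 : TangentSpace (𝓡 n) p) i = 0 := fun i => by
    rw [vecCoord, map_zero]
    rfl
  simp [hessian, hv]

/-- A smooth curve whose velocity vanishes identically is constant. -/
theorem eq_of_velocity_eq_zero {γ : ℝ → M} (hγ : ContMDiff 𝓘(ℝ, ℝ) (𝓡 n) ∞ γ)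
    (hv : ∀ t, velocity (n := n) γ t = 0) (s t : ℝ) : γ s = γ t := by
  have hmf : ∀ t, mfderiv 𝓘(ℝ, ℝ) (𝓡 n) γ t = 0 := fun t => ContinuousLinearMap.ext_ring (hv t)
  -- Local constancy suffices since `ℝ` is connected; near each time it is checked in one chart,
  -- which is injective on its source.
  refine IsLocallyConstant.apply_eq_of_isPreconnected (s := Set.univ)
    ((IsLocallyConstant.iff_eventually_eq γ).2 fun a => ?_) isPreconnected_univ
    (Set.mem_univ s) (Set.mem_univ t)
  have hsrc := hγ.continuous.continuousAt.eventually
    (extChartAt_source_mem_nhds (I := 𝓡 n) (γ a))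
  obtain ⟨ε, hε, hball⟩ := Metric.eventually_nhds_iff_ball.1 hsrc
  have hd : ∀ b ∈ Metric.ball a ε,
      HasFDerivAt (extChartAt (𝓡 n) (γ a) ∘ γ) (0 : ℝ →L[ℝ] EuclideanSpace ℝ (Fin n)) b := by
    intro b hb
    have hφ : MDifferentiableAt (𝓡 n) 𝓘(ℝ, EuclideanSpace ℝ (Fin n))
        (extChartAt (𝓡 n) (γ a)) (γ b) :=
      mdifferentiableAt_extChartAt ((extChartAt_source (𝓡 n) (γ a)) ▸ hball b hb)
    have hcomp := hφ.hasMFDerivAt.comp b (hγ.mdifferentiableAt (by simp) (x := b)).hasMFDerivAt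
    rw [hmf b, ContinuousLinearMap.comp_zero] at hcomp
    exact hcomp.hasFDerivAt
  filter_upwards [Metric.ball_mem_nhds a hε] with b hb
  have ha := Metric.mem_ball_self (x := a) hε
  have heq := (convex_ball a ε).is_const_of_fderivWithin_eq_zero (𝕜 := ℝ)
    (fun c hc => (hd c hc).differentiableAt.differentiableWithinAt)
    (fun c hc => (hd c hc).hasFDerivWithinAt.fderivWithin
      (Metric.isOpen_ball.uniqueDiffWithinAt hc)) hb ha
  exact (extChartAt (𝓡 n) (γ a)).injOn (hball b hb) (hball a ha) heq

/-- A periodic function on `ℝ` with nonnegative second derivative has vanishing second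
derivative. -/
theorem deriv_deriv_eq_zero_of_periodic {g : ℝ → ℝ} {T : ℝ} (hT : 0 < T)
    (hg : Function.Periodic g T) (hd : Differentiable ℝ (deriv g))
    (hnn : ∀ s, 0 ≤ deriv (deriv g) s) (s : ℝ) : deriv (deriv g) s = 0 := by
  have hmono : Monotone (deriv g) := monotone_of_deriv_nonneg hd hnn
  have hper : Function.Periodic (deriv g) T := fun t => by
    rw [← deriv_comp_add_const, hg.funext]
  have hconst : ∀ a b, a ≤ b → deriv g b ≤ deriv g a := fun a b hab => by
    -- Enough periods carry `a` past `b`, where the monotone derivative has returned to its value at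
    -- `a`.
    obtain ⟨k, hk⟩ := Archimedean.arch (b - a) hT
    calc deriv g b ≤ deriv g (a + k • T) := hmono (by linarith)
      _ = deriv g a := hper.nsmul k a
  have : deriv g = fun _ => deriv g 0 := by
    funext t
    rcases le_total t 0 with ht | ht
    · exact le_antisymm (hmono ht) (hconst _ _ ht)
    · exact le_antisymm (hconst _ _ ht) (hmono ht)
  rw [this, deriv_const]

end RiemConvex

theorem mainTheorem4 {n : ℕ} {M : Type*} [TopologicalSpace M]
    [ChartedSpace (EuclideanSpace ℝ (Fin n)) M] [IsManifold (𝓡 n) ∞ M]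
    (h : Bundle.ContMDiffRiemannianMetric (𝓡 n) ∞ (EuclideanSpace ℝ (Fin n))
      (TangentSpace (𝓡 n) : M → Type _))
    (f : M → ℝ)
    (hf : RiemConvex.IsStrictlyConvex h f ∨ RiemConvex.IsUniformlyConvex h f) :
    (¬ ∃ γ : ℝ → M, RiemConvex.IsClosedGeodesic h γ) ∧
      ∀ (γ : ℝ → M) (J : Set ℝ), IsOpen J → J.OrdConnected → RiemConvex.IsGeodesicOn h γ J →
        ∀ s ∈ J, RiemConvex.velocity (n := n) γ s ≠ 0 → 0 < deriv (deriv (f ∘ γ)) s := by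
  have hsm : ContMDiff (𝓡 n) 𝓘(ℝ, ℝ) ∞ f := hf.elim (·.1) (·.1)
  refine ⟨?_, fun γ J hJ _ hγ s hs hv => ?_⟩
  · rintro ⟨γ, ⟨hγ, hacc⟩, ⟨T, hT, hper⟩, a, b, hab⟩
    rw [contMDiffOn_univ] at hγ
    have hess : ∀ s, deriv (deriv (f ∘ γ)) s = _ := fun s =>
      RiemConvex.deriv_deriv_comp_eq_hessian h hsm hγ.contMDiffAt (hacc s (Set.mem_univ s))
    have hd : Differentiable ℝ (deriv (f ∘ γ)) :=
      ((contDiff_infty_iff_deriv.1 (hsm.comp hγ).contDiff).2).differentiable (by simp)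
    have hzero := RiemConvex.deriv_deriv_eq_zero_of_periodic hT (hper.comp f) hd fun s => by
      rw [hess s]
      -- A priori the velocity may vanish at some times, so only a weak inequality is available
      -- here.
      by_cases hv : RiemConvex.velocity (n := n) γ s = 0
      · rw [hv, RiemConvex.hessian_zero]
      · exact (RiemConvex.hessian_pos h hf hv).le
    refine hab (RiemConvex.eq_of_velocity_eq_zero hγ (fun t => ?_) a b)
    by_contra hv
    exact (RiemConvex.hessian_pos h hf hv).ne' ((hess t).symm.trans (hzero t))
  · rw [RiemConvex.deriv_deriv_comp_eq_hessian h hsm (hγ.1.contMDiffAt (hJ.mem_nhds hs))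
      (hγ.2 s hs)]
    exact RiemConvex.hessian_pos h hf hv
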